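/- Let $k,n$ be integers with $1\le k\le n-1$. Let $X_1,\dots,X_{n+1}$ be independent, identically distributed real random variables with cumulative distribution function $F$, $F(0)=0$, and probability density function $f$ with $f(0)>0$. Assume that $f$ is real analytic on $[0,\infty)$: for every $a\ge 0$ there is a power series in $x-a$ that converges to $f(x)$ for all $x\ge 0$ in a neighbourhood of $a$ (at $a=0$ this is a one-sided, Maclaurin, expansion). For $1\le j\le m\le n$ let $X_{j:m}$ be the $j$-th order statistic, that is, the $j$-th smallest of $X_1,\dots,X_m$. Then there is a $\lambda>0$ with $$F(x)=1-e^{-\lambda x}\qquad\text{for all } x\ge 0$$ if and only if $$X_{n-k:n-1}+\frac1n\,X_n\quad\text{and}\quad X_{n-k:n}+\frac1k\,X_{n+1}$$ have the same distribution. -/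

import Mathlib

open MeasureTheory ProbabilityTheory

/-- The `j`-th order statistic `x_{j:m}` (with `1 ≤ j ≤ m`): the `j`-th smallest of the `m` numbers
`x 0, …, x (m - 1)`, counted with multiplicity. `Tuple.sort x` is the permutation that sorts `x` in
nondecreasing order; its positions are numbered from `0`. -/
noncomputable def orderStat {m : ℕ} (x : Fin m → ℝ) (j : ℕ) (h1 : 1 ≤ j) (hm : j ≤ m) : ℝ :=
  x (Tuple.sort x ⟨j - 1, by omega⟩)

/-- The first `m` values of a sample of `N` values. -/
def firstValues {N : ℕ} (m : ℕ) (h : m ≤ N) (x : Fin N → ℝ) : Fin m → ℝ :=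
  fun i => x (Fin.castLE h i)

/-! Put `n = p + q + 2` and `k = q + 1`, so that both sums involve the order statistic of rank `p +
1`. Conditioning on it, the distribution functions of the sums at `x ≥ 0` differ by a positive
constant times `∫₀ˣ W(y) G(x, y) dy`, with `W = F^p (1 - F)^q f` and `G(x, y) = k F(n (x - y)) - n
(1 - F y) F(k (x - y))`. Equality in law means that this integral vanishes for all `x ≥ 0`.

For an exponential law the integrand has an explicit antiderivative
(`integral_orderWeight_mul_conditionalGap_exp`).

Conversely, let `l = f 0` and compare `f` with `f₀ y = l exp (-l y)`. If they differ near `0`,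
analyticity gives `f - f₀ ~ u₀ y^m` with `u₀ ≠ 0`, and `m ≥ 1` because `f 0 = f₀ 0`. Then `F - F₀ ~
c y^(m+1)` with `c = u₀ / (m + 1)`, and the two integrands differ by `l^(p+1) c (k n^(m+1) - n
k^(m+1)) y^p (x - y)^(m+1)` up to `O(x^(p+m+2))` (`isBigO_integrand_sub`). The change of `W` does
not enter the leading term, since the linear parts cancel in `G`. Both integrals vanish, so
integration makes a nonzero multiple of `x^(p+m+2)` equal to `O(x^(p+m+3))`, a contradiction
(`false_of_integral_eq_zero`). Hence `f = f₀` near `0`, and by the identity theorem on all of `(0,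
∞)`. -/

/-! ### Distribution of an order statistic -/

/-- The polynomial that expresses the distribution function of the `j`-th order statistic of a
sample of size `m` in terms of the distribution function of the sample. -/
noncomputable def orderPoly (m j : ℕ) : Polynomial ℝ :=
  ∑ i ∈ Finset.Ico j (m + 1), bernsteinPolynomial ℝ m i

/-- The derivative of each Bernstein polynomial is a difference of two consecutive ones of lower
degree, so the sum telescopes; the upper end has index above the degree and vanishes. -/
theorem derivative_orderPoly {m j : ℕ} (h1 : 1 ≤ j) (hm : j ≤ m) :
    (orderPoly m j).derivative = m * bernsteinPolynomial ℝ (m - 1) (j - 1) := by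
  obtain ⟨m, rfl⟩ : ∃ m', m = m' + 1 := ⟨m - 1, by omega⟩
  obtain ⟨j, rfl⟩ : ∃ j', j = j' + 1 := ⟨j - 1, by omega⟩
  rw [orderPoly, Polynomial.derivative_sum]
  obtain ⟨d, hd⟩ : ∃ d, m + 1 + 1 = j + 1 + d := ⟨m + 1 - j, by omega⟩
  have key : ∀ d, ∑ i ∈ Finset.Ico (j + 1) (j + 1 + d),
      (bernsteinPolynomial ℝ (m + 1) i).derivative = ((m + 1 : ℕ) : Polynomial ℝ) *
        (bernsteinPolynomial ℝ m j - bernsteinPolynomial ℝ m (j + d)) := by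
    intro d
    induction d with
    | zero => simp
    | succ d ih =>
      rw [← Nat.add_assoc, Finset.sum_Ico_succ_top (by omega), ih,
        show j + 1 + d = j + d + 1 by omega, bernsteinPolynomial.derivative_succ]
      simp only [Nat.add_sub_cancel, ← Nat.add_assoc]
      ring
  rw [hd, key d, bernsteinPolynomial.eq_zero_of_lt ℝ (show m < j + d by omega)]
  simp

theorem orderPoly_eval_zero {m j : ℕ} (h1 : 1 ≤ j) : (orderPoly m j).eval 0 = 0 := by
  rw [orderPoly, Polynomial.eval_finsetSum]
  refine Finset.sum_eq_zero fun i hi => ?_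
  rw [bernsteinPolynomial.eval_at_0, if_neg]
  have := (Finset.mem_Ico.1 hi).1
  omega

theorem orderStat_le_iff {m : ℕ} (x : Fin m → ℝ) (j : ℕ) (h1 : 1 ≤ j) (hm : j ≤ m) (a : ℝ) :
    orderStat x j h1 hm ≤ a ↔ j ≤ (Finset.univ.filter fun i => x i ≤ a).card := by
  have h := Tuple.lt_card_le_iff_apply_le_of_monotone (j := ⟨j - 1, by omega⟩) (a := a)
    (Tuple.monotone_sort x)
  have hc : (Finset.univ.filter fun i => (x ∘ Tuple.sort x) i ≤ a).card =
      (Finset.univ.filter fun i => x i ≤ a).card :=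
    Finset.card_equiv (Tuple.sort x) (by simp)
  rw [hc] at h
  rw [orderStat]
  refine h.symm.trans ?_
  simp only
  omega

/-- Splitting by the exact set `A` of indices with value at most `a` gives disjoint pieces, each an
intersection of events about single variables, to which independence applies. -/
theorem setOf_orderStat_le {Ω : Type*} {m : ℕ} (Y : Fin m → Ω → ℝ) (j : ℕ) (h1 : 1 ≤ j) (hm : j ≤ m) (a : ℝ) :
    {ω | orderStat (fun i => Y i ω) j h1 hm ≤ a} =
      ⋃ A ∈ Finset.univ.filter (fun A : Finset (Fin m) => j ≤ A.card),
        ⋂ i ∈ (Finset.univ : Finset (Fin m)), Y i ⁻¹' (if i ∈ A then Set.Iic a else Set.Ioi a) := by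
  ext ω
  simp only [Set.mem_ofPred_eq, orderStat_le_iff, Set.mem_iUnion, Set.mem_iInter, exists_prop,
    Finset.mem_filter, Finset.mem_univ, true_and, Set.mem_preimage, true_implies]
  constructor
  · intro h
    refine ⟨_, h, fun i => ?_⟩
    by_cases hi : Y i ω ≤ a
    · simp [hi]
    · simp [hi, not_le.1 hi]
  · rintro ⟨A, hA, h⟩
    refine hA.trans (Finset.card_le_card fun i hi => ?_)
    have := h i
    rw [if_pos hi] at this
    simpa using this

section law
variable {Ω : Type*} [MeasurableSpace Ω] {P : Measure Ω}

theorem measurable_orderStat {m : ℕ} {Y : Fin m → Ω → ℝ} (hY : ∀ i, Measurable (Y i))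
    (j : ℕ) (h1 : 1 ≤ j) (hm : j ≤ m) :
    Measurable fun ω => orderStat (fun i => Y i ω) j h1 hm := by
  refine measurable_of_Iic fun a => ?_
  have := setOf_orderStat_le Y j h1 hm a
  change MeasurableSet {ω | orderStat (fun i => Y i ω) j h1 hm ≤ a}
  rw [this]
  refine Finset.measurableSet_biUnion _ fun A _ => Finset.measurableSet_biInter _ fun i _ => ?_
  refine hY i ?_
  split_ifs
  · exact measurableSet_Iic
  · exact measurableSet_Ioi

theorem measureReal_orderStat_le [IsProbabilityMeasure P] {m : ℕ} {Y : Fin m → Ω → ℝ}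
    (hY : ∀ i, Measurable (Y i)) (hindep : iIndepFun Y P) (ν : Measure ℝ) [IsProbabilityMeasure ν]
    (hlaw : ∀ i, P.map (Y i) = ν) (j : ℕ) (h1 : 1 ≤ j) (hm : j ≤ m) (a : ℝ) :
    P.real {ω | orderStat (fun i => Y i ω) j h1 hm ≤ a} = (orderPoly m j).eval (cdf ν a) := by
  have hset : ∀ (A : Finset (Fin m)) (i : Fin m),
      MeasurableSet (if i ∈ A then Set.Iic a else Set.Ioi a) := by
    intro A i
    split_ifs
    · exact measurableSet_Iic
    · exact measurableSet_Ioi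
  have hone : ∀ (A : Finset (Fin m)), P.real (⋂ i ∈ (Finset.univ : Finset (Fin m)),
      Y i ⁻¹' (if i ∈ A then Set.Iic a else Set.Ioi a)) =
      (cdf ν a) ^ A.card * (1 - cdf ν a) ^ (m - A.card) := by
    intro A
    rw [measureReal_def, hindep.measure_inter_preimage_eq_mul _ (fun i _ => hset A i),
      ENNReal.toReal_prod]
    have : ∀ i, (P (Y i ⁻¹' (if i ∈ A then Set.Iic a else Set.Ioi a))).toReal =
        if i ∈ A then cdf ν a else 1 - cdf ν a := by
      intro i
      rw [← Measure.map_apply (hY i) (hset A i), hlaw i, ← measureReal_def]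
      split_ifs
      · rw [cdf_eq_real]
      · rw [cdf_eq_real, ← Set.compl_Iic, probReal_compl_eq_one_sub measurableSet_Iic]
    simp only [this]
    rw [Finset.prod_ite, Finset.prod_const, Finset.prod_const]
    congr 2
    · simp
    · rw [← Finset.compl_filter, Finset.card_compl]
      simp
  rw [setOf_orderStat_le, measureReal_biUnion_finset]
  · simp only [hone]
    rw [Finset.sum_filter]
    have := Finset.sum_powerset_apply_card (fun c => if j ≤ c then
      (cdf ν a) ^ c * (1 - cdf ν a) ^ (m - c) else 0)
      (x := (Finset.univ : Finset (Fin m)))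
    rw [Finset.powerset_univ] at this
    rw [this, orderPoly, Polynomial.eval_finsetSum, Finset.card_univ, Fintype.card_fin]
    simp only [smul_ite, smul_zero]
    rw [← Finset.sum_filter]
    refine Finset.sum_congr ?_ fun i _ => ?_
    · ext i
      simp only [Finset.mem_filter, Finset.mem_range, Finset.mem_Ico]
      omega
    · simp [bernsteinPolynomial, mul_assoc]
  · intro A _ B _ hAB
    rw [Function.onFun, Set.disjoint_left]
    intro ω hA hB
    apply hAB
    simp only [Set.mem_iInter, Finset.mem_univ, true_implies, Set.mem_preimage] at hA hB
    ext i
    have hA := hA i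
    have hB := hB i
    by_cases h : i ∈ A <;> by_cases h' : i ∈ B <;> simp_all
    · linarith
    · linarith
  · intro A _
    exact Finset.measurableSet_biInter _ fun i _ => hY i (hset A i)

end law

/-! ### The distribution function as a primitive of the density -/

section cdfDensity
theorem cdf_eq_zero_of_nonpos {ν : Measure ℝ} (h0 : cdf ν 0 = 0) {x : ℝ} (hx : x ≤ 0) : cdf ν x = 0 :=
  le_antisymm (h0 ▸ monotone_cdf ν hx) (cdf_nonneg ν x)

variable {ν : Measure ℝ} [IsProbabilityMeasure ν] {f : ℝ → ℝ}

theorem cdf_eq_intervalIntegral (hfnonneg : ∀ x, 0 ≤ f x)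
    (hpdf : ν = volume.withDensity (fun x => ENNReal.ofReal (f x))) (h0 : cdf ν 0 = 0)
    (hfc : ContinuousOn f (Set.Ici 0)) {x : ℝ} (hx : 0 ≤ x) :
    cdf ν x = ∫ y in (0 : ℝ)..x, f y := by
  have hint : IntegrableOn f (Set.Ioc 0 x) volume :=
    ((hfc.mono Set.Icc_subset_Ici_self).integrableOn_Icc).mono_set Set.Ioc_subset_Icc_self
  rw [cdf_eq_real] at h0
  rw [cdf_eq_real, ← Set.Iic_union_Ioc_eq_Iic hx, measureReal_union
    (Set.Iic_disjoint_Ioc le_rfl) measurableSet_Ioc, h0, zero_add,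
    intervalIntegral.integral_of_le hx, integral_eq_lintegral_of_nonneg_ae
      (Filter.Eventually.of_forall fun y => hfnonneg y) hint.aestronglyMeasurable, measureReal_def]
  congr 1
  conv_lhs => rw [hpdf]
  rw [withDensity_apply _ measurableSet_Ioc]

end cdfDensity

section primitive
variable {F f : ℝ → ℝ}

theorem hasDerivAt_of_eq_intervalIntegral (hfc : ContinuousOn f (Set.Ici 0))
    (hF : ∀ x, 0 ≤ x → F x = ∫ y in (0 : ℝ)..x, f y) {x : ℝ} (hx : 0 < x) :
    HasDerivAt F (f x) x := by
  have hc : ContinuousAt f x := hfc.continuousAt (Ici_mem_nhds hx)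
  have h : HasDerivAt (fun u => ∫ y in (0 : ℝ)..u, f y) (f x) x := by
    refine intervalIntegral.integral_hasDerivAt_right ?_ ?_ hc
    · refine ContinuousOn.intervalIntegrable (hfc.mono ?_)
      rw [Set.uIcc_of_le hx.le]
      exact Set.Icc_subset_Ici_self
    · exact (hfc.mono Set.Ioi_subset_Ici_self).stronglyMeasurableAtFilter isOpen_Ioi x hx
  exact h.congr_of_eventuallyEq (by
    filter_upwards [Ioi_mem_nhds hx] with u hu using hF u (le_of_lt hu))

theorem continuousOn_of_eq_intervalIntegral (hfc : ContinuousOn f (Set.Ici 0))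
    (hF : ∀ x, 0 ≤ x → F x = ∫ y in (0 : ℝ)..x, f y) : ContinuousOn F (Set.Ici 0) := by
  intro x hx
  have h1 : ContinuousOn (fun u => ∫ y in (0 : ℝ)..u, f y) (Set.Icc 0 (x + 1)) := by
    have hx1 : 0 ≤ x + 1 := add_nonneg hx zero_le_one
    have := intervalIntegral.continuousOn_primitive_interval (μ := volume) (f := f)
      (a := 0) (b := x + 1)
    rw [Set.uIcc_of_le hx1] at this
    exact this (hfc.mono Set.Icc_subset_Ici_self).integrableOn_Icc
  have h2 : ContinuousOn F (Set.Icc 0 (x + 1)) := h1.congr fun u hu => hF u hu.1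
  refine (h2 x ⟨hx, by linarith⟩).mono_of_mem_nhdsWithin ?_
  rw [← Set.Ici_inter_Iic]
  exact Filter.inter_mem self_mem_nhdsWithin
    (mem_nhdsWithin_of_mem_nhds (Iic_mem_nhds (by linarith)))

end primitive

/-! ### Law of an order statistic plus an independent multiple of a sample variable -/

section law
variable {Ω : Type*} [MeasurableSpace Ω] {P : Measure Ω} [IsProbabilityMeasure P]
  {ν : Measure ℝ}

theorem map_eq_withDensity_of_measureReal_le {f : ℝ → ℝ} (hfc : ContinuousOn f (Set.Ici 0))
    (hF : ∀ x, 0 ≤ x → cdf ν x = ∫ y in (0 : ℝ)..x, f y) (h0 : cdf ν 0 = 0)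
    {Y : Ω → ℝ} (hY : Measurable Y) (B : Polynomial ℝ) (hB0 : B.eval 0 = 0)
    (hB : ∀ x, 0 ≤ x → 0 ≤ B.derivative.eval (cdf ν x) * f x)
    (hlaw : ∀ a, P.real {ω | Y ω ≤ a} = B.eval (cdf ν a)) :
    P.map Y = (volume.restrict (Set.Ioi 0)).withDensity
      (fun y => ENNReal.ofReal (B.derivative.eval (cdf ν y) * f y)) := by
  have hprob : IsProbabilityMeasure (P.map Y) := Measure.isProbabilityMeasure_map hY.aemeasurable
  refine Measure.ext_of_Iic _ _ fun a => ?_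
  rw [Measure.map_apply hY measurableSet_Iic, withDensity_apply _ measurableSet_Iic,
    Measure.restrict_restrict measurableSet_Iic]
  have hl : P (Y ⁻¹' Set.Iic a) = ENNReal.ofReal (B.eval (cdf ν a)) := by
    rw [← hlaw a, measureReal_def, ENNReal.ofReal_toReal (measure_ne_top _ _)]
    rfl
  rw [hl]
  rcases le_total a 0 with ha | ha
  · rw [cdf_eq_zero_of_nonpos h0 ha, hB0, Set.inter_comm, Set.Ioi_inter_Iic, Set.Ioc_eq_empty
      (not_lt.2 ha)]
    simp
  · have hcF := continuousOn_of_eq_intervalIntegral hfc hF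
    have hc : ContinuousOn (fun y => B.derivative.eval (cdf ν y) * f y) (Set.Ici 0) :=
      (B.derivative.continuous.comp_continuousOn hcF).mul hfc
    have hc' := hc.mono (Set.Icc_subset_Ici_self : Set.Icc 0 a ⊆ Set.Ici 0)
    rw [Set.inter_comm, Set.Ioi_inter_Iic, ← ofReal_integral_eq_lintegral_ofReal]
    · rw [← intervalIntegral.integral_of_le ha,
        intervalIntegral.integral_eq_sub_of_hasDerivAt_of_le ha (f := fun y => B.eval (cdf ν y)),
        h0, hB0, sub_zero]
      · exact (B.continuous.comp_continuousOn hcF).mono Set.Icc_subset_Ici_self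
      · intro x hx
        exact (B.hasDerivAt (cdf ν x)).comp x
          (hasDerivAt_of_eq_intervalIntegral hfc hF hx.1)
      · exact ContinuousOn.intervalIntegrable (by rwa [Set.uIcc_of_le ha])
    · exact hc'.integrableOn_Icc.mono_set Set.Ioc_subset_Icc_self
    · filter_upwards [ae_restrict_mem measurableSet_Ioc] with y hy using hB y hy.1.le

/-- Fubini over the value `y` of `Y`: the condition on `Z` becomes `Z ≤ s (a - y)`, which has
probability zero for `y > a`. -/
theorem measure_add_le [IsProbabilityMeasure ν] (h0 : cdf ν 0 = 0) {Y Z : Ω → ℝ}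
    (hY : Measurable Y) (hZ : Measurable Z) (hYZ : IndepFun Y Z P) (hlawZ : P.map Z = ν)
    {w : ℝ → ℝ} (hw : Measurable w) (hwn : ∀ y, 0 ≤ y → 0 ≤ w y)
    (hlawY : P.map Y = (volume.restrict (Set.Ioi 0)).withDensity fun y => ENNReal.ofReal (w y))
    {s : ℝ} (hs : 0 < s) (a : ℝ) :
    P {ω | Y ω + 1 / s * Z ω ≤ a} =
      ∫⁻ y in Set.Ioc 0 a, ENNReal.ofReal (w y * cdf ν (s * (a - y))) := by
  have hmF : Measurable fun y => cdf ν (s * (a - y)) :=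
    (monotone_cdf ν).measurable.comp (by fun_prop)
  have hS : MeasurableSet {p : ℝ × ℝ | p.1 + 1 / s * p.2 ≤ a} :=
    measurableSet_le (by fun_prop) measurable_const
  have h1 : P {ω | Y ω + 1 / s * Z ω ≤ a} =
      P.map (fun ω => (Y ω, Z ω)) {p : ℝ × ℝ | p.1 + 1 / s * p.2 ≤ a} := by
    rw [Measure.map_apply (hY.prodMk hZ) hS]
    rfl
  have h2 : ∀ y, ν (Prod.mk y ⁻¹' {p : ℝ × ℝ | p.1 + 1 / s * p.2 ≤ a}) =
      ENNReal.ofReal (cdf ν (s * (a - y))) := by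
    intro y
    rw [ofReal_cdf]
    congr 1
    ext t
    simp only [Set.mem_preimage, Set.mem_ofPred_eq, Set.mem_Iic]
    rw [← le_sub_iff_add_le', one_div, inv_mul_le_iff₀ hs]
  rw [h1, (indepFun_iff_map_prod_eq_prod_map_map hY.aemeasurable hZ.aemeasurable).1 hYZ, hlawZ]
  rw [Measure.prod_apply hS]
  simp only [h2]
  rw [hlawY, lintegral_withDensity_eq_lintegral_mul _ hw.ennreal_ofReal hmF.ennreal_ofReal]
  have h3 : ∫⁻ y in Set.Ioi 0, ((fun y => ENNReal.ofReal (w y)) *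
      fun y => ENNReal.ofReal (cdf ν (s * (a - y)))) y =
      ∫⁻ y in Set.Ioi 0, (Set.Iic a).indicator
        (fun y => ENNReal.ofReal (w y * cdf ν (s * (a - y)))) y := by
    refine setLIntegral_congr_fun measurableSet_Ioi fun y hy => ?_
    by_cases hya : y ≤ a
    · simp only [Pi.mul_apply]
      rw [Set.indicator_of_mem (Set.mem_Iic.2 hya), ENNReal.ofReal_mul (hwn y (le_of_lt hy))]
    · simp only [Pi.mul_apply]
      rw [Set.indicator_of_notMem (by simpa using hya), cdf_eq_zero_of_nonpos h0
        (mul_nonpos_of_nonneg_of_nonpos hs.le (by linarith)), ENNReal.ofReal_zero, mul_zero]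
  rw [h3, lintegral_indicator measurableSet_Iic, Measure.restrict_restrict measurableSet_Iic,
    Set.inter_comm, Set.Ioi_inter_Iic]

end law

theorem continuousOn_eval_mul_mul_comp {F f : ℝ → ℝ} (hF : ContinuousOn F (Set.Ici 0))
    (hf : ContinuousOn f (Set.Ici 0)) (c : ℝ) (B : Polynomial ℝ) {s : ℝ} (hs : 0 ≤ s) (a : ℝ) :
    ContinuousOn (fun y => c * B.eval (F y) * f y * F (s * (a - y))) (Set.Icc 0 a) :=
  ContinuousOn.mul (((continuousOn_const.mul (B.continuous.comp_continuousOn hF)).mul hf).mono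
    Set.Icc_subset_Ici_self) (hF.comp (by fun_prop) fun _ hy => mul_nonneg hs (sub_nonneg.2 hy.2))

section law
variable {Ω : Type*} [MeasurableSpace Ω] {P : Measure Ω} [IsProbabilityMeasure P]
  {ν : Measure ℝ} [IsProbabilityMeasure ν] {f : ℝ → ℝ}

omit [IsProbabilityMeasure P] in
theorem indepFun_orderStat_firstValues {N : ℕ} {X : Fin N → Ω → ℝ} (hX : ∀ i, Measurable (X i))
    (hindep : iIndepFun X P) {m j : ℕ} (h1 : 1 ≤ j) (hm : j ≤ m) (hmN : m < N) :
    IndepFun (fun ω => orderStat (firstValues m hmN.le fun i => X i ω) j h1 hm)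
      (X ⟨m, hmN⟩) P := by
  have h := hindep.indepFun_finset (Finset.univ.filter fun i : Fin N => i.val < m) {⟨m, hmN⟩}
    (by simp) hX
  have hmem : ∀ i : Fin m, Fin.castLE hmN.le i ∈ Finset.univ.filter fun i : Fin N => i.val < m :=
    fun i => by simp
  have hφ : Measurable fun v : ((Finset.univ.filter fun i : Fin N => i.val < m) → ℝ) =>
      orderStat (fun i : Fin m => v ⟨Fin.castLE hmN.le i, hmem i⟩) j h1 hm :=
    measurable_orderStat (fun i => measurable_pi_apply _) j h1 hm
  have hψ : Measurable fun v : (({⟨m, hmN⟩} : Finset (Fin N)) → ℝ) =>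
      v ⟨⟨m, hmN⟩, Finset.mem_singleton_self _⟩ := measurable_pi_apply _
  exact h.comp hφ hψ

theorem measureReal_orderStat_add_le {N : ℕ} {X : Fin N → Ω → ℝ} (hX : ∀ i, Measurable (X i))
    (hindep : iIndepFun X P) (hlaw : ∀ i, P.map (X i) = ν) (hfmeas : Measurable f)
    (hfnonneg : ∀ x, 0 ≤ f x) (hfc : ContinuousOn f (Set.Ici 0))
    (hF : ∀ x, 0 ≤ x → cdf ν x = ∫ y in (0 : ℝ)..x, f y) (h0 : cdf ν 0 = 0)
    {m j : ℕ} (h1 : 1 ≤ j) (hm : j ≤ m) (hmN : m < N) {s : ℝ} (hs : 0 < s) (a : ℝ) :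
    P.real {ω | orderStat (firstValues m hmN.le fun i => X i ω) j h1 hm +
      1 / s * X ⟨m, hmN⟩ ω ≤ a} =
      ∫ y in (0 : ℝ)..(max a 0),
        m * (bernsteinPolynomial ℝ (m - 1) (j - 1)).eval (cdf ν y) * f y *
          cdf ν (s * (a - y)) := by
  set B := orderPoly m j with hBdef
  have hBd : ∀ u, B.derivative.eval u =
      m * (bernsteinPolynomial ℝ (m - 1) (j - 1)).eval u := by
    intro u
    rw [hBdef, derivative_orderPoly h1 hm]
    simp
  have hBn : ∀ x, 0 ≤ B.derivative.eval (cdf ν x) * f x := by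
    intro x
    refine mul_nonneg ?_ (hfnonneg x)
    rw [hBd]
    have h2 := cdf_nonneg ν x
    have h3 : 0 ≤ 1 - cdf ν x := by linarith [cdf_le_one ν x]
    simp only [bernsteinPolynomial, Polynomial.eval_mul, Polynomial.eval_natCast,
      Polynomial.eval_pow, Polynomial.eval_X, Polynomial.eval_sub, Polynomial.eval_one]
    positivity
  have hY : Measurable fun ω => orderStat (firstValues m hmN.le fun i => X i ω) j h1 hm :=
    measurable_orderStat (Y := fun i => X (Fin.castLE hmN.le i)) (fun i => hX _) j h1 hm
  have hlawY := map_eq_withDensity_of_measureReal_le hfc hF h0 hY B (orderPoly_eval_zero h1)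
    (fun x _ => hBn x) (measureReal_orderStat_le (Y := fun i => X (Fin.castLE hmN.le i))
      (fun i => hX _) (hindep.precomp (Fin.castLE_injective hmN.le)) ν (fun i => hlaw _) j h1 hm)
  have hw : Measurable fun y => B.derivative.eval (cdf ν y) * f y :=
    (B.derivative.continuous.measurable.comp (monotone_cdf ν).measurable).mul hfmeas
  rw [measureReal_def, measure_add_le h0 hY (hX _) (indepFun_orderStat_firstValues hX hindep h1 hm hmN) (hlaw _)
    hw (fun y _ => hBn y) hlawY hs a]
  simp only [← hBd]
  rcases le_total a 0 with ha | ha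
  · simp [ha]
  · have hcF := continuousOn_of_eq_intervalIntegral hfc hF
    have hc := continuousOn_eval_mul_mul_comp hcF hfc 1 B.derivative hs.le a
    simp only [one_mul] at hc
    have hn : ∀ y, 0 ≤ B.derivative.eval (cdf ν y) * f y * cdf ν (s * (a - y)) := fun y =>
      mul_nonneg (hBn y) (cdf_nonneg ν _)
    rw [max_eq_left ha, intervalIntegral.integral_of_le ha, ← ofReal_integral_eq_lintegral_ofReal,
      ENNReal.toReal_ofReal (integral_nonneg hn)]
    · exact hc.integrableOn_Icc.mono_set Set.Ioc_subset_Icc_self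
    · exact Filter.Eventually.of_forall hn

theorem identDistrib_iff_measureReal_le {U V : Ω → ℝ} (hU : Measurable U) (hV : Measurable V) :
    IdentDistrib U V P P ↔ ∀ a, P.real {ω | U ω ≤ a} = P.real {ω | V ω ≤ a} := by
  constructor
  · intro h a
    rw [measureReal_def, measureReal_def]
    exact congrArg _ (h.measure_mem_eq measurableSet_Iic)
  · intro h
    have := Measure.isProbabilityMeasure_map (μ := P) hU.aemeasurable
    refine ⟨hU.aemeasurable, hV.aemeasurable, Measure.ext_of_Iic _ _ fun a => ?_⟩
    rw [Measure.map_apply hU measurableSet_Iic, Measure.map_apply hV measurableSet_Iic]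
    exact (measureReal_eq_measureReal_iff).1 (h a)

end law

/-! ### The integral equation for exponential laws -/

/-- The density of an order statistic, up to a constant factor. -/
def orderWeight (p q : ℕ) (F f : ℝ → ℝ) (y : ℝ) : ℝ := F y ^ p * ((1 - F y) ^ q * f y)

/-- The difference of the conditional distribution functions of the two sums, up to a constant
factor, given the value `y` of the order statistic. -/
def conditionalGap (p q : ℕ) (F : ℝ → ℝ) (x y : ℝ) : ℝ :=
  (q + 1) * F ((p + q + 2) * (x - y)) - (p + q + 2) * ((1 - F y) * F ((q + 1) * (x - y)))

theorem integral_orderWeight_mul_conditionalGap_exp (p q : ℕ) (l x : ℝ) :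
    ∫ y in (0 : ℝ)..x, orderWeight p q (fun y => 1 - Real.exp (-l * y))
      (fun y => l * Real.exp (-l * y)) y *
      conditionalGap p q (fun y => 1 - Real.exp (-l * y)) x y = 0 := by
  set b := Real.exp (-l * ((q + 1) * x)) with hb
  set a := Real.exp (-l * ((p + q + 2) * x)) with ha
  have hp : (p : ℝ) + 1 ≠ 0 := by positivity
  have hQ : ∀ y, HasDerivAt (fun y => Real.exp (-l * y)) (Real.exp (-l * y) * -l) y := fun y => by
    simpa using ((hasDerivAt_id y).const_mul (-l)).exp
  have hE : ∀ y, HasDerivAt (fun y => Real.exp (l * y)) (Real.exp (l * y) * l) y := fun y => by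
    simpa using ((hasDerivAt_id y).const_mul l).exp
  have hQE : ∀ y, Real.exp (-l * y) * Real.exp (l * y) = 1 := fun y => by
    rw [← Real.exp_add]; simp
  -- With `Q = exp (-l y)` and `E = 1 / Q`, the integrand is the sum of `l (1 - Q)^p Q^(q+1) ((q +
  -- 1) - (p + q + 2) Q)`, `(p + q + 2) b l Q (1 - Q)^p` and `-(q + 1) a l E (E - 1)^p`; the three
  -- terms below are their antiderivatives.
  rw [intervalIntegral.integral_eq_sub_of_hasDerivAt (f := fun y =>
    -((1 - Real.exp (-l * y)) ^ (p + 1) * Real.exp (-l * y) ^ (q + 1)) +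
      (p + q + 2) / (p + 1) * b * (1 - Real.exp (-l * y)) ^ (p + 1) -
      (q + 1) / (p + 1) * a * (Real.exp (l * y) - 1) ^ (p + 1))]
  · have h1 : b = Real.exp (-l * x) ^ (q + 1) := by
      rw [hb, ← Real.exp_nat_mul]; congr 1; push_cast; ring
    have h2 : a = Real.exp (-l * x) ^ (p + 1) * Real.exp (-l * x) ^ (q + 1) := by
      rw [ha, ← pow_add, ← Real.exp_nat_mul]; congr 1; push_cast; ring
    have h3 : Real.exp (-l * x) ^ (p + 1) * (Real.exp (l * x) - 1) ^ (p + 1) =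
        (1 - Real.exp (-l * x)) ^ (p + 1) := by
      rw [← mul_pow, mul_sub, hQE, mul_one]
    have h4 : a * (Real.exp (l * x) - 1) ^ (p + 1) =
        (1 - Real.exp (-l * x)) ^ (p + 1) * Real.exp (-l * x) ^ (q + 1) := by
      rw [h2, ← h3]; ring
    simp only [mul_zero, Real.exp_zero, sub_self, zero_pow (Nat.succ_ne_zero p), zero_mul, neg_zero,
      add_zero, sub_zero]
    rw [mul_assoc _ a, h4, h1]
    field_simp
    ring
  · intro y _
    have h1 : Real.exp (-l * ((q + 1) * (x - y))) = b * Real.exp (l * y) ^ (q + 1) := by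
      rw [hb, ← Real.exp_nat_mul, ← Real.exp_add]; congr 1; push_cast; ring
    have h2 : Real.exp (-l * ((p + q + 2) * (x - y))) =
        a * (Real.exp (l * y) ^ p * (Real.exp (l * y) * Real.exp (l * y) ^ (q + 1))) := by
      rw [ha, ← pow_succ', ← pow_add, ← Real.exp_nat_mul, ← Real.exp_add]
      congr 1; push_cast; ring
    have hd := ((((hQ y).const_sub 1).pow (p + 1)).mul ((hQ y).pow (q + 1))).neg.add
      ((((hQ y).const_sub 1).pow (p + 1)).const_mul ((p + q + 2) / (p + 1) * b)) |>.sub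
      ((((hE y).sub_const 1).pow (p + 1)).const_mul ((q + 1) / (p + 1) * a))
    refine HasDerivAt.congr_deriv hd ?_
    rw [orderWeight, conditionalGap, h1, h2]
    have h5 : Real.exp (-l * y) * Real.exp (l * y) = 1 := hQE y
    have h6 : (Real.exp (l * y) - 1) ^ p = Real.exp (l * y) ^ p * (1 - Real.exp (-l * y)) ^ p := by
      rw [← mul_pow, mul_sub, mul_comm (Real.exp (l * y)) (Real.exp (-l * y)), h5, mul_one]
    have h7 : Real.exp (-l * y) ^ q * Real.exp (l * y) ^ q = 1 := by
      rw [← mul_pow, h5, one_pow]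
    simp only [Nat.add_sub_cancel, Pi.pow_apply]
    rw [h6]
    generalize Real.exp (-l * y) = Q at *
    generalize Real.exp (l * y) = E at *
    push_cast
    field_simp
    have h8 : Q * E * (Q ^ q * E ^ q) = 1 := by rw [h5, h7, one_mul]
    linear_combination (l * (q + 1) * a * E ^ p * E * (1 - Q) ^ p -
      l * Q * (p + q + 2) * b * (1 - Q) ^ p) * h8
  · refine Continuous.intervalIntegrable ?_ _ _
    unfold orderWeight conditionalGap
    fun_prop

/-! ### Expansion of the integrand near the origin -/

section asymptotics
open Asymptotics Filter Topology

/-- Writing the error as `u * v` gives the expected order of `u^(p-1) * (u * v)` without the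
exponent `p - 1`, so `p = 0` needs no separate treatment. -/
theorem isBigO_pow_sub_pow {α : Type*} {l : Filter α} {a b u v : α → ℝ} (ha : a =O[l] u)
    (hb : b =O[l] u) (hab : (fun x => a x - b x) =O[l] fun x => u x * v x) (p : ℕ) :
    (fun x => a x ^ p - b x ^ p) =O[l] fun x => u x ^ p * v x := by
  induction p with
  | zero => simpa using isBigO_zero _ _
  | succ p ih =>
    have h1 : (fun x => a x ^ p * (a x - b x)) =O[l] fun x => u x ^ (p + 1) * v x :=
      ((ha.pow p).mul hab).congr_right fun x => by ring
    have h2 : (fun x => (a x ^ p - b x ^ p) * b x) =O[l] fun x => u x ^ (p + 1) * v x :=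
      (ih.mul hb).congr_right fun x => by ring
    exact (h1.add h2).congr_left fun x => by ring

theorem isBigO_pow_pow_of_tendsto_zero {α : Type*} {l : Filter α} {u : α → ℝ}
    (hu : Tendsto u l (𝓝 0)) {i j : ℕ} (hij : j ≤ i) :
    (fun x => u x ^ i) =O[l] fun x => u x ^ j := by
  refine IsBigO.of_bound 1 ?_
  filter_upwards [hu.norm.eventually_le_const (show ‖(0 : ℝ)‖ < 1 by simp)] with x hx
  rw [one_mul, norm_pow, norm_pow]
  exact pow_le_pow_of_le_one (norm_nonneg _) hx hij

theorem tendsto_id_nhdsGE_zero : Tendsto (fun y : ℝ => y) (𝓝[≥] 0) (𝓝 0) :=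
  tendsto_id.mono_left nhdsWithin_le_nhds

theorem isBigO_intervalIntegral_pow {g : ℝ → ℝ} {j : ℕ}
    (hg : g =O[𝓝[≥] 0] fun y => y ^ j) :
    (fun x => ∫ y in (0 : ℝ)..x, g y) =O[𝓝[≥] 0] fun x => x ^ (j + 1) := by
  obtain ⟨C, hC, h⟩ := hg.exists_pos
  rw [IsBigOWith] at h
  obtain ⟨η, hη, hη'⟩ := mem_nhdsGE_iff_exists_Ico_subset.1 h
  refine IsBigO.of_bound C ?_
  filter_upwards [Ico_mem_nhdsGE hη] with x hx
  have : ∀ y ∈ Set.uIoc 0 x, ‖g y‖ ≤ C * x ^ j := by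
    intro y hy
    rw [Set.uIoc_of_le hx.1] at hy
    have h1 := hη' (show y ∈ Set.Ico 0 η from ⟨hy.1.le, hy.2.trans_lt hx.2⟩)
    simp only [Set.mem_ofPred_eq] at h1
    refine h1.trans (mul_le_mul_of_nonneg_left ?_ hC.le)
    rw [norm_pow, Real.norm_of_nonneg hy.1.le]
    exact pow_le_pow_left₀ hy.1.le hy.2 j
  refine (intervalIntegral.norm_integral_le_of_norm_le_const this).trans_eq ?_
  rw [sub_zero, norm_pow, Real.norm_of_nonneg hx.1, abs_of_nonneg hx.1]
  ring

section weights
variable {F F0 f f0 : ℝ → ℝ} {l : ℝ} {m : ℕ}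

theorem isBigO_tail_mul_sub (hF : F =O[𝓝[≥] 0] fun y => y) (hF0 : F0 =O[𝓝[≥] 0] fun y => y)
    (hE : (fun y => F y - F0 y) =O[𝓝[≥] 0] fun y => y ^ m)
    (hf : (fun y => f y - f0 y) =O[𝓝[≥] 0] fun y => y ^ m)
    (hf1 : f =O[𝓝[≥] 0] fun _ => (1 : ℝ)) (q : ℕ) :
    (fun y => (1 - F y) ^ q * f y - (1 - F0 y) ^ q * f0 y) =O[𝓝[≥] 0] fun y => y ^ m := by
  have hone : ∀ {G : ℝ → ℝ}, G =O[𝓝[≥] 0] (fun y => y) →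
      (fun y => 1 - G y) =O[𝓝[≥] 0] fun _ => (1 : ℝ) := fun hG =>
    (isBigO_refl _ _).sub (hG.trans (tendsto_id_nhdsGE_zero.isBigO_one ℝ))
  have h1 : (fun y => (1 - F y) ^ q - (1 - F0 y) ^ q) =O[𝓝[≥] 0] fun y => y ^ m := by
    have := isBigO_pow_sub_pow (v := fun y => y ^ m) (hone hF) (hone hF0)
      (hE.neg_left.congr (fun y => by ring) fun y => by ring) q
    exact this.congr_right fun y => by simp
  have h2 : (fun y => ((1 - F y) ^ q - (1 - F0 y) ^ q) * f y) =O[𝓝[≥] 0] fun y => y ^ m :=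
    (h1.mul hf1).congr_right fun y => by ring
  have h3 : (fun y => (1 - F0 y) ^ q * (f y - f0 y)) =O[𝓝[≥] 0] fun y => y ^ m :=
    (((hone hF0).pow q).mul hf).congr_right fun y => by ring
  exact (h2.add h3).congr_left fun y => by ring

theorem isBigO_orderWeight_sub (hF : F =O[𝓝[≥] 0] fun y => y) (hF0 : F0 =O[𝓝[≥] 0] fun y => y)
    (hE : (fun y => F y - F0 y) =O[𝓝[≥] 0] fun y => y ^ (m + 1))
    (hf : (fun y => f y - f0 y) =O[𝓝[≥] 0] fun y => y ^ m)
    (hf1 : f =O[𝓝[≥] 0] fun _ => (1 : ℝ)) (p q : ℕ) :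
    (fun y => orderWeight p q F f y - orderWeight p q F0 f0 y) =O[𝓝[≥] 0]
      fun y => y ^ (p + m) := by
  have hM : (fun y => (1 - F y) ^ q * f y) =O[𝓝[≥] 0] fun _ => (1 : ℝ) := by
    have : (fun y => 1 - F y) =O[𝓝[≥] 0] fun _ => (1 : ℝ) :=
      (isBigO_refl _ _).sub (hF.trans (tendsto_id_nhdsGE_zero.isBigO_one ℝ))
    exact ((this.pow q).mul hf1).congr_right fun y => by simp
  have hE' := hE.trans (isBigO_pow_pow_of_tendsto_zero tendsto_id_nhdsGE_zero (Nat.le_succ m))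
  have h1 := isBigO_pow_sub_pow (v := fun y => y ^ m) hF hF0
    (hE.congr_right fun y => by ring) p
  have h2 : (fun y => (F y ^ p - F0 y ^ p) * ((1 - F y) ^ q * f y)) =O[𝓝[≥] 0]
      fun y => y ^ (p + m) := (h1.mul hM).congr_right fun y => by ring
  have h3 : (fun y => F0 y ^ p * ((1 - F y) ^ q * f y - (1 - F0 y) ^ q * f0 y)) =O[𝓝[≥] 0]
      fun y => y ^ (p + m) :=
    ((hF0.pow p).mul (isBigO_tail_mul_sub hF hF0 hE' hf hf1 q)).congr_right fun y => by ring
  exact (h2.add h3).congr_left fun y => by simp only [orderWeight]; ring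

theorem isBigO_orderWeight_sub_pow (hF : F =O[𝓝[≥] 0] fun y => y)
    (hFl : (fun y => F y - l * y) =O[𝓝[≥] 0] fun y => y ^ 2)
    (hfl : (fun y => f y - l) =O[𝓝[≥] 0] fun y => y)
    (hf1 : f =O[𝓝[≥] 0] fun _ => (1 : ℝ)) (p q : ℕ) :
    (fun y => orderWeight p q F f y - l ^ (p + 1) * y ^ p) =O[𝓝[≥] 0] fun y => y ^ (p + 1) := by
  have hM : (fun y => (1 - F y) ^ q * f y) =O[𝓝[≥] 0] fun _ => (1 : ℝ) := by
    have : (fun y => 1 - F y) =O[𝓝[≥] 0] fun _ => (1 : ℝ) :=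
      (isBigO_refl _ _).sub (hF.trans (tendsto_id_nhdsGE_zero.isBigO_one ℝ))
    exact ((this.pow q).mul hf1).congr_right fun y => by simp
  have hM' : (fun y => (1 - F y) ^ q * f y - l) =O[𝓝[≥] 0] fun y => y := by
    have := isBigO_tail_mul_sub (F0 := fun _ => 0) (f0 := fun _ => l) (m := 1) hF (isBigO_zero _ _)
      (by simpa using hF) (by simpa using hfl) hf1 q
    simpa using this
  have hly : (fun y => l * y) =O[𝓝[≥] 0] fun y => y := isBigO_const_mul_self l _ _
  have h1 := isBigO_pow_sub_pow (v := fun y => y) hF hly (hFl.congr_right fun y => by ring) p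
  have h2 : (fun y => (F y ^ p - (l * y) ^ p) * ((1 - F y) ^ q * f y)) =O[𝓝[≥] 0]
      fun y => y ^ (p + 1) := (h1.mul hM).congr_right fun y => by ring
  have h3 : (fun y => (l * y) ^ p * ((1 - F y) ^ q * f y - l)) =O[𝓝[≥] 0]
      fun y => y ^ (p + 1) := ((hly.pow p).mul hM').congr_right fun y => by ring
  exact (h2.add h3).congr_left fun y => by simp only [orderWeight]; ring

/-- The pairs `(x, y)` with `0 ≤ y ≤ x`. -/
def orderedPairs : Set (ℝ × ℝ) := {z | 0 ≤ z.2 ∧ z.2 ≤ z.1}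

/-- Working along the filter of pairs `0 ≤ y ≤ x` makes the estimates uniform in `y`, so that they
can be integrated over `[0, x]`. -/
theorem tendsto_snd_orderedPairs : Tendsto (fun z : ℝ × ℝ => z.2) (𝓝[orderedPairs] 0) (𝓝[≥] 0) :=
  tendsto_nhdsWithin_iff.2 ⟨(continuous_snd.tendsto' 0 0 rfl).mono_left nhdsWithin_le_nhds, by
    filter_upwards [self_mem_nhdsWithin] with z hz using hz.1⟩

theorem tendsto_mul_sub_orderedPairs {a : ℝ} (ha : 0 ≤ a) :
    Tendsto (fun z : ℝ × ℝ => a * (z.1 - z.2)) (𝓝[orderedPairs] 0) (𝓝[≥] 0) :=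
  tendsto_nhdsWithin_iff.2 ⟨(Continuous.tendsto' (by fun_prop) 0 0 (by simp)).mono_left
    nhdsWithin_le_nhds, by
    filter_upwards [self_mem_nhdsWithin] with z hz using mul_nonneg ha (sub_nonneg.2 hz.2)⟩

theorem isBigO_snd_orderedPairs :
    (fun z : ℝ × ℝ => z.2) =O[𝓝[orderedPairs] 0] fun z => z.1 := by
  refine IsBigO.of_bound 1 ?_
  filter_upwards [self_mem_nhdsWithin] with z hz
  rw [one_mul, Real.norm_of_nonneg hz.1, Real.norm_of_nonneg (hz.1.trans hz.2)]
  exact hz.2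

theorem isBigO_mul_sub_orderedPairs (a : ℝ) :
    (fun z : ℝ × ℝ => a * (z.1 - z.2)) =O[𝓝[orderedPairs] 0] fun z => z.1 :=
  ((isBigO_refl _ _).sub isBigO_snd_orderedPairs).const_mul_left a

theorem isBigO_comp_snd {g : ℝ → ℝ} {j : ℕ} (hg : g =O[𝓝[≥] 0] fun y => y ^ j) :
    (fun z : ℝ × ℝ => g z.2) =O[𝓝[orderedPairs] 0] fun z => z.1 ^ j :=
  (hg.comp_tendsto tendsto_snd_orderedPairs).trans (isBigO_snd_orderedPairs.pow j)

theorem isBigO_comp_mul_sub {g : ℝ → ℝ} {j : ℕ} (hg : g =O[𝓝[≥] 0] fun y => y ^ j) {a : ℝ}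
    (ha : 0 ≤ a) :
    (fun z : ℝ × ℝ => g (a * (z.1 - z.2))) =O[𝓝[orderedPairs] 0] fun z => z.1 ^ j :=
  (hg.comp_tendsto (tendsto_mul_sub_orderedPairs ha)).trans
    ((isBigO_mul_sub_orderedPairs a).pow j)

/-- The linear parts `(q + 1) l (p + q + 2) (x - y)` and `(p + q + 2) l (q + 1) (x - y)` cancel; the
rest is quadratic. -/
theorem isBigO_conditionalGap (hF0 : F0 =O[𝓝[≥] 0] fun y => y)
    (hF0l : (fun y => F0 y - l * y) =O[𝓝[≥] 0] fun y => y ^ 2) (p q : ℕ) :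
    (fun z : ℝ × ℝ => conditionalGap p q F0 z.1 z.2) =O[𝓝[orderedPairs] 0]
      fun z => z.1 ^ 2 := by
  have hn : (0 : ℝ) ≤ p + q + 2 := by positivity
  have hk : (0 : ℝ) ≤ q + 1 := by positivity
  have hF0' : F0 =O[𝓝[≥] 0] fun y => y ^ 1 := by simpa using hF0
  have h1 := (isBigO_comp_mul_sub hF0l hn).const_mul_left (q + 1 : ℝ)
  have h2 := (isBigO_comp_mul_sub hF0l hk).const_mul_left (p + q + 2 : ℝ)
  have h3 := (((isBigO_comp_snd hF0').mul (isBigO_comp_mul_sub hF0' hk)).const_mul_left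
    (p + q + 2 : ℝ)).congr_right (g₂ := fun z : ℝ × ℝ => z.1 ^ 2) fun z => by ring
  exact ((h1.sub h2).add h3).congr_left fun z => by simp only [conditionalGap]; ring

/-- Only the terms linear in `F` contribute at order `m + 1`; in the product `F y * F ((q + 1) (x -
y))` the error gains a further factor of order `x`. -/
theorem isBigO_conditionalGap_sub (hF : F =O[𝓝[≥] 0] fun y => y)
    (hF0 : F0 =O[𝓝[≥] 0] fun y => y) {c : ℝ}
    (hE : (fun y => F y - F0 y - c * y ^ (m + 1)) =O[𝓝[≥] 0] fun y => y ^ (m + 2)) (p q : ℕ) :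
    (fun z : ℝ × ℝ => conditionalGap p q F z.1 z.2 - conditionalGap p q F0 z.1 z.2 -
      c * ((q + 1) * (p + q + 2) ^ (m + 1) - (p + q + 2) * (q + 1) ^ (m + 1)) *
        (z.1 - z.2) ^ (m + 1)) =O[𝓝[orderedPairs] 0] fun z => z.1 ^ (m + 2) := by
  have hn : (0 : ℝ) ≤ p + q + 2 := by positivity
  have hk : (0 : ℝ) ≤ q + 1 := by positivity
  have hF0' : F0 =O[𝓝[≥] 0] fun y => y ^ 1 := by simpa using hF0
  have hF' : F =O[𝓝[≥] 0] fun y => y ^ 1 := by simpa using hF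
  have hE' : (fun y => F y - F0 y) =O[𝓝[≥] 0] fun y => y ^ (m + 1) :=
    ((hE.trans (isBigO_pow_pow_of_tendsto_zero tendsto_id_nhdsGE_zero (Nat.le_succ _))).add
      (isBigO_const_mul_self c _ _)).congr_left fun y => by ring
  have h1 := (isBigO_comp_mul_sub hE hn).const_mul_left (q + 1 : ℝ)
  have h2 := (isBigO_comp_mul_sub hE hk).const_mul_left (p + q + 2 : ℝ)
  have h3 := (((isBigO_comp_snd hF').mul (isBigO_comp_mul_sub hE' hk)).const_mul_left
    (p + q + 2 : ℝ)).congr_right (g₂ := fun z : ℝ × ℝ => z.1 ^ (m + 2)) fun z => by ring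
  have h4 := (((isBigO_comp_snd hE').mul (isBigO_comp_mul_sub hF0' hk)).const_mul_left
    (p + q + 2 : ℝ)).congr_right (g₂ := fun z : ℝ × ℝ => z.1 ^ (m + 2)) fun z => by ring
  exact (((h1.sub h2).add h3).add h4).congr_left fun z => by
    simp only [conditionalGap, mul_pow]; ring

/-- With weights `W`, `W₀`, gaps `G`, `G₀` and `t = D (x - y)^(m+1)`, the expression is `W (G - G₀ -
t) + (W - l^(p+1) y^p) t + (W - W₀) G₀`. Each summand has order `p + m + 2`; the last one does
because `G₀` is quadratic. -/
theorem isBigO_integrand_sub (hF : F =O[𝓝[≥] 0] fun y => y)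
    (hF0 : F0 =O[𝓝[≥] 0] fun y => y) {c : ℝ}
    (hE : (fun y => F y - F0 y - c * y ^ (m + 1)) =O[𝓝[≥] 0] fun y => y ^ (m + 2))
    (hFl : (fun y => F y - l * y) =O[𝓝[≥] 0] fun y => y ^ 2)
    (hF0l : (fun y => F0 y - l * y) =O[𝓝[≥] 0] fun y => y ^ 2)
    (hf : (fun y => f y - f0 y) =O[𝓝[≥] 0] fun y => y ^ m)
    (hfl : (fun y => f y - l) =O[𝓝[≥] 0] fun y => y) (p q : ℕ) :
    (fun z : ℝ × ℝ => orderWeight p q F f z.2 * conditionalGap p q F z.1 z.2 -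
      orderWeight p q F0 f0 z.2 * conditionalGap p q F0 z.1 z.2 -
      l ^ (p + 1) * (c * ((q + 1) * (p + q + 2) ^ (m + 1) - (p + q + 2) * (q + 1) ^ (m + 1))) *
        (z.2 ^ p * (z.1 - z.2) ^ (m + 1))) =O[𝓝[orderedPairs] 0]
      fun z => z.1 ^ (p + m + 2) := by
  have hf1 : f =O[𝓝[≥] 0] fun _ => (1 : ℝ) :=
    ((hfl.trans (tendsto_id_nhdsGE_zero.isBigO_one ℝ)).add
      (isBigO_const_const l one_ne_zero _)).congr_left fun y => by ring
  have hE' : (fun y => F y - F0 y) =O[𝓝[≥] 0] fun y => y ^ (m + 1) :=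
    ((hE.trans (isBigO_pow_pow_of_tendsto_zero tendsto_id_nhdsGE_zero (Nat.le_succ _))).add
      (isBigO_const_mul_self c _ _)).congr_left fun y => by ring
  have hW1 := isBigO_orderWeight_sub_pow hF hFl hfl hf1 p q
  have hW : orderWeight p q F f =O[𝓝[≥] 0] fun y => y ^ p :=
    ((hW1.trans (isBigO_pow_pow_of_tendsto_zero tendsto_id_nhdsGE_zero (Nat.le_succ _))).add
      (isBigO_const_mul_self (l ^ (p + 1)) _ _)).congr_left fun y => by ring
  set D : ℝ := c * ((q + 1) * (p + q + 2) ^ (m + 1) - (p + q + 2) * (q + 1) ^ (m + 1)) with hD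
  have ht : (fun z : ℝ × ℝ => D * (z.1 - z.2) ^ (m + 1)) =O[𝓝[orderedPairs] 0]
      fun z => z.1 ^ (m + 1) :=
    ((by simpa using (isBigO_mul_sub_orderedPairs 1).pow (m + 1) :
      (fun z : ℝ × ℝ => (z.1 - z.2) ^ (m + 1)) =O[𝓝[orderedPairs] 0]
      fun z => z.1 ^ (m + 1))).const_mul_left D
  have h1 := ((isBigO_comp_snd hW).mul (isBigO_conditionalGap_sub hF hF0 hE p q)).congr_right
    (g₂ := fun z : ℝ × ℝ => z.1 ^ (p + m + 2)) fun z => by ring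
  have h2 := ((isBigO_comp_snd hW1).mul ht).congr_right
    (g₂ := fun z : ℝ × ℝ => z.1 ^ (p + m + 2)) fun z => by ring
  have h3 := ((isBigO_comp_snd (isBigO_orderWeight_sub hF hF0 hE' hf hf1 p q)).mul
    (isBigO_conditionalGap hF0 hF0l p q)).congr_right
    (g₂ := fun z : ℝ × ℝ => z.1 ^ (p + m + 2)) fun z => by ring
  exact ((h1.add h2).add h3).congr_left fun z => by ring

end weights
end asymptotics

/-! ### Uniqueness of the solution of the integral equation -/

section characterization
open Asymptotics Filter Topology

theorem integral_pow_mul_sub_pow (p s : ℕ) (x : ℝ) :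
    ∫ y in (0 : ℝ)..x, y ^ p * (x - y) ^ s =
      x ^ (p + s + 1) * ∫ y in (0 : ℝ)..1, y ^ p * (1 - y) ^ s := by
  have h := intervalIntegral.mul_integral_comp_mul_left (a := 0) (b := 1)
    (f := fun y : ℝ => y ^ p * (x - y) ^ s) x
  rw [mul_zero, mul_one] at h
  rw [← h, pow_succ' x, mul_assoc, ← intervalIntegral.integral_const_mul (x ^ (p + s))]
  congr 2
  ext y
  rw [show x - x * y = x * (1 - y) by ring, mul_pow, mul_pow, pow_add]
  ring

theorem integral_pow_mul_one_sub_pow_pos (p s : ℕ) :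
    0 < ∫ y in (0 : ℝ)..1, y ^ p * (1 - y) ^ s := by
  refine intervalIntegral.intervalIntegral_pos_of_pos_on
    (Continuous.intervalIntegrable (by fun_prop) _ _) (fun y hy => ?_) one_pos
  exact mul_pos (pow_pos hy.1 _) (pow_pos (sub_pos.2 hy.2) _)

theorem exists_bound_of_isBigO_orderedPairs {g : ℝ × ℝ → ℝ} {j : ℕ}
    (hg : g =O[𝓝[orderedPairs] 0] fun z => z.1 ^ j) :
    ∃ C > 0, ∃ ε > 0, ∀ x y, 0 ≤ y → y ≤ x → x < ε → ‖g (x, y)‖ ≤ C * x ^ j := by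
  obtain ⟨C, hC, h⟩ := hg.exists_pos
  rw [IsBigOWith, eventually_nhdsWithin_iff, Metric.eventually_nhds_iff] at h
  obtain ⟨ε, hε, h⟩ := h
  refine ⟨C, hC, ε, hε, fun x y hy hyx hx => ?_⟩
  have h1 := h (y := (x, y)) (by
    rw [dist_zero_right, Prod.norm_def, Real.norm_of_nonneg hy,
      Real.norm_of_nonneg (hy.trans hyx)]
    exact max_lt hx (hyx.trans_lt hx)) ⟨hy, hyx⟩
  rwa [norm_pow, Real.norm_of_nonneg (hy.trans hyx)] at h1

theorem continuousOn_integrand {F f : ℝ → ℝ} (hF : ContinuousOn F (Set.Ici 0))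
    (hf : ContinuousOn f (Set.Ici 0)) (p q : ℕ) (x : ℝ) :
    ContinuousOn (fun y => orderWeight p q F f y * conditionalGap p q F x y) (Set.Icc 0 x) := by
  have hF' := hF.mono (Set.Icc_subset_Ici_self : Set.Icc 0 x ⊆ Set.Ici 0)
  have hf' := hf.mono (Set.Icc_subset_Ici_self : Set.Icc 0 x ⊆ Set.Ici 0)
  have hcomp : ∀ a : ℝ, 0 ≤ a → ContinuousOn (fun y => F (a * (x - y))) (Set.Icc 0 x) :=
    fun a ha => hF.comp (by fun_prop) fun y hy => mul_nonneg ha (sub_nonneg.2 hy.2)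
  have h1 := hcomp (p + q + 2) (by positivity)
  have h2 := hcomp (q + 1) (by positivity)
  exact ((hF'.pow p).mul (((continuousOn_const.sub hF').pow q).mul hf')).mul
    ((continuousOn_const.mul h1).sub
      (continuousOn_const.mul ((continuousOn_const.sub hF').mul h2)))

theorem false_of_integral_eq_zero {F F0 f f0 : ℝ → ℝ} {l c : ℝ} {m : ℕ} (p q : ℕ)
    (hl : l ≠ 0) (hc : c ≠ 0) (hm : m ≠ 0)
    (hFc : ContinuousOn F (Set.Ici 0)) (hfc : ContinuousOn f (Set.Ici 0))
    (hF0c : ContinuousOn F0 (Set.Ici 0)) (hf0c : ContinuousOn f0 (Set.Ici 0))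
    (h : ∀ x, 0 ≤ x →
      ∫ y in (0 : ℝ)..x, orderWeight p q F f y * conditionalGap p q F x y = 0)
    (h0 : ∀ x, 0 ≤ x →
      ∫ y in (0 : ℝ)..x, orderWeight p q F0 f0 y * conditionalGap p q F0 x y = 0)
    (hO : (fun z : ℝ × ℝ => orderWeight p q F f z.2 * conditionalGap p q F z.1 z.2 -
      orderWeight p q F0 f0 z.2 * conditionalGap p q F0 z.1 z.2 -
      l ^ (p + 1) * (c * ((q + 1) * (p + q + 2) ^ (m + 1) - (p + q + 2) * (q + 1) ^ (m + 1))) *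
        (z.2 ^ p * (z.1 - z.2) ^ (m + 1))) =O[𝓝[orderedPairs] 0]
      fun z => z.1 ^ (p + m + 2)) : False := by
  set D : ℝ :=
    l ^ (p + 1) * (c * ((q + 1) * (p + q + 2) ^ (m + 1) - (p + q + 2) * (q + 1) ^ (m + 1))) with hD
  set β := ∫ y in (0 : ℝ)..1, y ^ p * (1 - y) ^ (m + 1) with hβ
  have hβpos : 0 < β := integral_pow_mul_one_sub_pow_pos p (m + 1)
  -- The bracket equals `k n (n^m - k^m)` with `k = q + 1 < n = p + q + 2`, nonzero because `m ≠ 0`.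
  have hD0 : D ≠ 0 := by
    refine mul_ne_zero (pow_ne_zero _ hl) (mul_ne_zero hc ?_)
    have h1 : ((q : ℝ) + 1) ^ m < (p + q + 2) ^ m :=
      pow_lt_pow_left₀ (by linarith [p.cast_nonneg (α := ℝ)]) (by positivity) hm
    have h2 : (q + 1 : ℝ) * (p + q + 2) ^ (m + 1) - (p + q + 2) * (q + 1) ^ (m + 1) =
      (q + 1) * (p + q + 2) * ((p + q + 2) ^ m - (q + 1) ^ m) := by ring
    rw [h2]
    have := sub_pos.2 h1
    positivity
  obtain ⟨C, hC, ε, hε, hbound⟩ := exists_bound_of_isBigO_orderedPairs hO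
  clear_value D β
  have hK : 0 < |D| * β := mul_pos (abs_pos.2 hD0) hβpos
  have main : ∀ x, 0 < x → x < ε → |D| * β ≤ C * x := by
    intro x hx hxε
    have hi : ∀ {G g : ℝ → ℝ}, ContinuousOn G (Set.Ici 0) → ContinuousOn g (Set.Ici 0) →
        IntervalIntegrable (fun y => orderWeight p q G g y * conditionalGap p q G x y)
          volume 0 x := fun hG hg => ContinuousOn.intervalIntegrable (by
      rw [Set.uIcc_of_le hx.le]; exact continuousOn_integrand hG hg p q x)
    have h1 : ∀ y ∈ Set.uIoc 0 x, ‖orderWeight p q F f y * conditionalGap p q F x y -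
        orderWeight p q F0 f0 y * conditionalGap p q F0 x y - D * (y ^ p * (x - y) ^ (m + 1))‖ ≤
        C * x ^ (p + m + 2) := by
      intro y hy
      rw [Set.uIoc_of_le hx.le] at hy
      exact hbound x y hy.1.le hy.2 hxε
    have h2 := intervalIntegral.norm_integral_le_of_norm_le_const h1
    rw [intervalIntegral.integral_sub ((hi hFc hfc).sub (hi hF0c hf0c))
      (Continuous.intervalIntegrable (by fun_prop) _ _),
      intervalIntegral.integral_sub (hi hFc hfc) (hi hF0c hf0c), h x hx.le, h0 x hx.le,
      intervalIntegral.integral_const_mul, integral_pow_mul_sub_pow, sub_zero, zero_sub, norm_neg,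
      sub_zero, abs_of_pos hx, ← hβ, norm_mul, norm_mul, Real.norm_eq_abs, norm_pow,
      Real.norm_of_nonneg hx.le, Real.norm_of_nonneg hβpos.le] at h2
    have hxp : 0 < x ^ (p + m + 2) := pow_pos hx _
    refine le_of_mul_le_mul_right ?_ hxp
    calc |D| * β * x ^ (p + m + 2) = |D| * (x ^ (p + (m + 1) + 1) * β) := by ring
      _ ≤ C * x ^ (p + m + 2) * x := h2
      _ = C * x * x ^ (p + m + 2) := by ring
  -- At this point `C * x` is at most half of `|D| * β`, against `main`.
  have hx0 : 0 < min (ε / 2) (|D| * β / (2 * C)) := by positivity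
  have h1 := main _ hx0 ((min_le_left _ _).trans_lt (by linarith))
  have h2 : C * min (ε / 2) (|D| * β / (2 * C)) ≤ C * (|D| * β / (2 * C)) :=
    mul_le_mul_of_nonneg_left (min_le_right _ _) hC.le
  have h3 : C * (|D| * β / (2 * C)) = |D| * β / 2 := by field_simp
  linarith

theorem one_sub_exp_eq_intervalIntegral (l x : ℝ) :
    1 - Real.exp (-l * x) = ∫ y in (0 : ℝ)..x, l * Real.exp (-l * y) := by
  rw [intervalIntegral.integral_eq_sub_of_hasDerivAt (f := fun y => 1 - Real.exp (-l * y))]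
  · simp
  · intro y _
    have := (((hasDerivAt_id y).const_mul (-l)).exp).const_sub 1
    refine this.congr_deriv ?_
    simp [mul_comm]
  · exact Continuous.intervalIntegrable (by fun_prop) _ _

theorem eventuallyEq_exp_of_integral_eq_zero {F f : ℝ → ℝ} (p q : ℕ)
    (hf : AnalyticOn ℝ f (Set.Ici 0)) (hF : ∀ x, 0 ≤ x → F x = ∫ y in (0 : ℝ)..x, f y)
    (hf0 : f 0 ≠ 0)
    (h : ∀ x, 0 ≤ x →
      ∫ y in (0 : ℝ)..x, orderWeight p q F f y * conditionalGap p q F x y = 0) :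
    f =ᶠ[𝓝[≥] 0] fun y => f 0 * Real.exp (-f 0 * y) := by
  set l := f 0 with hl
  set f0 : ℝ → ℝ := fun y => l * Real.exp (-l * y) with hf0def
  set F0 : ℝ → ℝ := fun y => 1 - Real.exp (-l * y) with hF0def
  have hF0 : ∀ x, 0 ≤ x → F0 x = ∫ y in (0 : ℝ)..x, f0 y := fun x _ =>
    one_sub_exp_eq_intervalIntegral l x
  have hfc : ContinuousOn f (Set.Ici 0) := hf.continuousOn
  have hf0c : Continuous f0 := by fun_prop
  have hi : ∀ {g : ℝ → ℝ} {x : ℝ}, ContinuousOn g (Set.Ici 0) → 0 ≤ x →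
      IntervalIntegrable g volume 0 x := fun hg hx => ContinuousOn.intervalIntegrable (by
    rw [Set.uIcc_of_le hx]; exact hg.mono Set.Icc_subset_Ici_self)
  -- Analyticity of `f` at `0` is one-sided; `g` is a two-sided analytic extension, whose order of
  -- agreement with `f0` at `0` can be taken.
  obtain ⟨g, -, hfg, hg⟩ := (hf 0 Set.self_mem_Ici).exists_analyticAt
  rw [Set.insert_eq_of_mem Set.self_mem_Ici] at hfg
  have hf0a : AnalyticAt ℝ f0 0 := by fun_prop
  have hle : (𝓝[≥] (0 : ℝ)) ≤ 𝓝 0 := nhdsWithin_le_nhds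
  by_contra hne
  have hne' : ¬ ∀ᶠ z in 𝓝 (0 : ℝ), (g - f0) z = 0 := by
    intro hz
    apply hne
    filter_upwards [hle hz, self_mem_nhdsWithin] with y hy hy0
    rw [hfg hy0]
    exact sub_eq_zero.1 hy
  obtain ⟨m, u, hu, hu0, hgu⟩ := (hg.sub hf0a).exists_eventuallyEq_pow_smul_nonzero_iff.2 hne'
  simp only [sub_zero, smul_eq_mul, Pi.sub_apply] at hgu
  -- `f` and `f0` agree at `0`, so their difference cannot have order zero there.
  have hm : m ≠ 0 := by
    rintro rfl
    have h1 := hgu.self_of_nhds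
    rw [← hfg Set.self_mem_Ici, ← hl] at h1
    apply hu0
    simpa [hf0def] using h1.symm
  have he : ∀ᶠ y in 𝓝[≥] (0 : ℝ), f y - f0 y = y ^ m * u y := by
    filter_upwards [hle hgu, self_mem_nhdsWithin] with y hy hy0
    rw [hfg hy0, hy]
  have hu1 : (fun y => u y - u 0) =O[𝓝[≥] 0] fun y => y := by
    simpa using hu.differentiableAt.isBigO_sub.mono hle
  have hf0l : (fun y => f0 y - l) =O[𝓝[≥] 0] fun y => y := by
    simpa [hf0def] using hf0a.differentiableAt.isBigO_sub.mono hle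
  have hec : (fun y => f y - f0 y - u 0 * y ^ m) =O[𝓝[≥] 0] fun y => y ^ (m + 1) := by
    refine (((isBigO_refl (fun y : ℝ => y ^ m) _).mul hu1).congr_right fun y => by
      rw [pow_succ]).congr' ?_ EventuallyEq.rfl
    filter_upwards [he] with y hy
    rw [hy]; ring
  have hem : (fun y => f y - f0 y) =O[𝓝[≥] 0] fun y => y ^ m :=
    ((hec.trans (isBigO_pow_pow_of_tendsto_zero tendsto_id_nhdsGE_zero (Nat.le_succ _))).add
      (isBigO_const_mul_self (u 0) _ _)).congr_left fun y => by ring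
  have hfl : (fun y => f y - l) =O[𝓝[≥] 0] fun y => y := by
    have h1 : (fun y : ℝ => y ^ m) =O[𝓝[≥] 0] fun y => y := by
      simpa using isBigO_pow_pow_of_tendsto_zero tendsto_id_nhdsGE_zero
        (Nat.one_le_iff_ne_zero.2 hm)
    exact ((hem.trans h1).add hf0l).congr_left fun y => by ring
  have hlin : ∀ {G k : ℝ → ℝ}, ContinuousOn k (Set.Ici 0) →
      (∀ x, 0 ≤ x → G x = ∫ y in (0 : ℝ)..x, k y) →
      (fun y => k y - l) =O[𝓝[≥] 0] (fun y => y) →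
      (fun y => G y - l * y) =O[𝓝[≥] 0] fun y => y ^ 2 := by
    intro G k hk hG hkl
    refine (isBigO_intervalIntegral_pow (j := 1) (by simpa using hkl)).congr' ?_ EventuallyEq.rfl
    filter_upwards [self_mem_nhdsWithin] with x hx
    rw [intervalIntegral.integral_sub (hi hk hx) (Continuous.intervalIntegrable (by fun_prop) _ _),
      hG x hx]
    simp [mul_comm]
  have hFl := hlin hfc hF hfl
  have hF0l := hlin hf0c.continuousOn hF0 hf0l
  have hO1 : ∀ {G : ℝ → ℝ}, (fun y => G y - l * y) =O[𝓝[≥] 0] (fun y => y ^ 2) →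
      G =O[𝓝[≥] 0] fun y => y := fun hG => by
    have h1 : (fun y : ℝ => y ^ 2) =O[𝓝[≥] 0] fun y => y := by
      simpa using isBigO_pow_pow_of_tendsto_zero tendsto_id_nhdsGE_zero one_le_two
    exact ((hG.trans h1).add (isBigO_const_mul_self l _ _)).congr_left fun y => by ring
  -- Integrating `u 0 * y ^ m` produces the constant `u 0 / (m + 1)`.
  have hE : (fun y => F y - F0 y - u 0 / (m + 1) * y ^ (m + 1)) =O[𝓝[≥] 0]
      fun y => y ^ (m + 2) := by
    refine (isBigO_intervalIntegral_pow hec).congr' ?_ EventuallyEq.rfl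
    filter_upwards [self_mem_nhdsWithin] with x hx
    rw [intervalIntegral.integral_sub ((hi hfc hx).sub (hi hf0c.continuousOn hx))
      (Continuous.intervalIntegrable (by fun_prop) _ _),
      intervalIntegral.integral_sub (hi hfc hx) (hi hf0c.continuousOn hx), hF x hx, hF0 x hx,
      intervalIntegral.integral_const_mul (u 0), integral_pow]
    simp
    ring
  refine false_of_integral_eq_zero (c := u 0 / (m + 1)) p q hf0
    (div_ne_zero hu0 (by positivity)) hm
    (continuousOn_of_eq_intervalIntegral hfc hF) hfc (by fun_prop) hf0c.continuousOn h
    (fun x _ => integral_orderWeight_mul_conditionalGap_exp p q l x)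
    (isBigO_integrand_sub (hO1 hFl) (hO1 hF0l) hE hFl hF0l hem hfl p q)

theorem eqOn_exp_of_integral_eq_zero {F f : ℝ → ℝ} (p q : ℕ)
    (hf : AnalyticOn ℝ f (Set.Ici 0)) (hF : ∀ x, 0 ≤ x → F x = ∫ y in (0 : ℝ)..x, f y)
    (hf0 : f 0 ≠ 0)
    (h : ∀ x, 0 ≤ x →
      ∫ y in (0 : ℝ)..x, orderWeight p q F f y * conditionalGap p q F x y = 0) :
    Set.EqOn f (fun y => f 0 * Real.exp (-f 0 * y)) (Set.Ioi 0) := by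
  have hev := eventuallyEq_exp_of_integral_eq_zero p q hf hF hf0 h
  obtain ⟨η, hη, hη'⟩ := mem_nhdsGE_iff_exists_Ico_subset.1 hev
  have hη0 : (0 : ℝ) < η := hη
  have ha : AnalyticOnNhd ℝ f (Set.Ioi 0) :=
    (isOpen_Ioi.analyticOn_iff_analyticOnNhd).1 (hf.mono Set.Ioi_subset_Ici_self)
  -- The identity theorem needs an interior base point, so it is applied at `η / 2` instead of `0`.
  refine ha.eqOn_of_preconnected_of_eventuallyEq (fun y _ => by fun_prop) isPreconnected_Ioi
    (z₀ := η / 2) (half_pos hη0) ?_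
  filter_upwards [Ioo_mem_nhds (half_pos hη0) (half_lt_self hη0)] with y hy
  exact hη' ⟨hy.1.le, hy.2⟩

theorem eq_mul_exp_of_eq_one_sub_exp {F f : ℝ → ℝ} (hfc : ContinuousOn f (Set.Ici 0))
    (hF : ∀ x, 0 ≤ x → F x = ∫ y in (0 : ℝ)..x, f y) {l : ℝ}
    (h : ∀ x, 0 ≤ x → F x = 1 - Real.exp (-l * x)) {x : ℝ} (hx : 0 < x) :
    f x = l * Real.exp (-l * x) := by
  have h1 := hasDerivAt_of_eq_intervalIntegral hfc hF hx
  have h2 : HasDerivAt (fun y => 1 - Real.exp (-l * y)) (l * Real.exp (-l * x)) x := by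
    refine (((hasDerivAt_id x).const_mul (-l)).exp.const_sub 1).congr_deriv ?_
    simp [mul_comm]
  refine h1.unique (h2.congr_of_eventuallyEq ?_)
  filter_upwards [Ioi_mem_nhds hx] with y hy using h y (le_of_lt hy)

/-- Exponential laws are the only ones for which the two conditional distribution functions
have the same mean. -/
theorem exists_eq_one_sub_exp_iff_integral_eq_zero {F f : ℝ → ℝ} (p q : ℕ)
    (hf : AnalyticOn ℝ f (Set.Ici 0)) (hF : ∀ x, 0 ≤ x → F x = ∫ y in (0 : ℝ)..x, f y)
    (hf0 : 0 < f 0) :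
    (∃ l : ℝ, 0 < l ∧ ∀ x : ℝ, 0 ≤ x → F x = 1 - Real.exp (-l * x)) ↔
      ∀ x, 0 ≤ x →
        ∫ y in (0 : ℝ)..x, orderWeight p q F f y * conditionalGap p q F x y = 0 := by
  constructor
  · rintro ⟨l, hl, h⟩ x hx
    refine Eq.trans ?_ (integral_orderWeight_mul_conditionalGap_exp p q l x)
    refine intervalIntegral.integral_congr_ae (μ := volume) (Eventually.of_forall fun y hy => ?_)
    rw [Set.uIoc_of_le hx] at hy
    have hxy := sub_nonneg.2 hy.2
    simp only [orderWeight, conditionalGap]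
    rw [eq_mul_exp_of_eq_one_sub_exp hf.continuousOn hF h hy.1, h y hy.1.le,
      h _ (show (0 : ℝ) ≤ (p + q + 2) * (x - y) by positivity),
      h _ (show (0 : ℝ) ≤ (q + 1) * (x - y) by positivity)]
  · intro h
    refine ⟨f 0, hf0, fun x hx => ?_⟩
    rw [hF x hx, one_sub_exp_eq_intervalIntegral]
    refine intervalIntegral.integral_congr_ae (μ := volume) (Eventually.of_forall fun y hy => ?_)
    rw [Set.uIoc_of_le hx] at hy
    exact eqOn_exp_of_integral_eq_zero p q hf hF hf0.ne' h hy.1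

end characterization

/-! ### From equality in law to the integral equation -/

/-- The sample variable written `X_i` with `1 ≤ i ≤ n + 1` is `X ⟨i - 1, _⟩` here. -/
theorem mainTheorem1 {Ω : Type*} [MeasurableSpace Ω] (P : Measure Ω) [IsProbabilityMeasure P]
    (k n : ℕ) (hk : 1 ≤ k) (hkn : k < n)
    (X : Fin (n + 1) → Ω → ℝ) (hX : ∀ i, Measurable (X i)) (hindep : iIndepFun X P)
    (ν : Measure ℝ) [IsProbabilityMeasure ν] (hlaw : ∀ i, P.map (X i) = ν)
    (f : ℝ → ℝ) (hfmeas : Measurable f) (hfnonneg : ∀ x, 0 ≤ f x)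
    (hpdf : ν = volume.withDensity (fun x => ENNReal.ofReal (f x)))
    (hF0 : cdf ν 0 = 0) (hf0 : 0 < f 0) (hf : AnalyticOn ℝ f (Set.Ici 0)) :
    (∃ l : ℝ, 0 < l ∧ ∀ x : ℝ, 0 ≤ x → cdf ν x = 1 - Real.exp (-l * x)) ↔
      IdentDistrib
        (fun ω => orderStat (firstValues (n - 1) (by omega) (fun i => X i ω)) (n - k)
            (by omega) (by omega) + (1 / (n : ℝ)) * X ⟨n - 1, by omega⟩ ω)
        (fun ω => orderStat (firstValues n (by omega) (fun i => X i ω)) (n - k)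
            (by omega) (by omega) + (1 / (k : ℝ)) * X ⟨n, by omega⟩ ω)
        P P := by
  have hfc : ContinuousOn f (Set.Ici 0) := hf.continuousOn
  have hF := fun x hx => cdf_eq_intervalIntegral hfnonneg hpdf hF0 hfc (x := x) hx
  have hcF := continuousOn_of_eq_intervalIntegral hfc hF
  obtain ⟨q, rfl⟩ : ∃ q, k = q + 1 := ⟨k - 1, by omega⟩
  obtain ⟨p, rfl⟩ : ∃ p, n = p + q + 2 := ⟨n - q - 2, by omega⟩
  have hmeas : ∀ (m : ℕ) (hm : m < p + q + 2 + 1) (h1 : 1 ≤ p + q + 2 - (q + 1))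
      (h2 : p + q + 2 - (q + 1) ≤ m) (s : ℝ), Measurable fun ω =>
      orderStat (firstValues m hm.le (fun i => X i ω)) (p + q + 2 - (q + 1)) h1 h2 +
        1 / s * X ⟨m, hm⟩ ω := fun m hm h1 h2 s =>
    (measurable_orderStat (Y := fun i => X (Fin.castLE hm.le i)) (fun i => hX _) _ h1 h2).add
      ((hX _).const_mul _)
  have hlt : p + q + 2 - 1 < p + q + 2 + 1 := by omega
  rw [exists_eq_one_sub_exp_iff_integral_eq_zero p q hf hF hf0,
    identDistrib_iff_measureReal_le (hmeas _ hlt _ _ _) (hmeas _ (Nat.lt_succ_self _) _ _ _)]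
  have hn0 : (0 : ℝ) < ((p + q + 2 : ℕ) : ℝ) := by positivity
  have hk0 : (0 : ℝ) < ((q + 1 : ℕ) : ℝ) := by positivity
  have hU := measureReal_orderStat_add_le hX hindep hlaw hfmeas hfnonneg hfc hF hF0
    (j := p + q + 2 - (q + 1)) (by omega) (by omega) hlt hn0
  have hV := measureReal_orderStat_add_le hX hindep hlaw hfmeas hfnonneg hfc hF hF0
    (j := p + q + 2 - (q + 1)) (by omega) (by omega) (Nat.lt_succ_self (p + q + 2)) hk0
  have hκ : (0 : ℝ) < ((p + q + 1).choose p : ℝ) := by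
    exact_mod_cast Nat.choose_pos (by omega)
  -- This identity gives both densities the common factor `(p + q + 1).choose p`, leaving the
  -- coefficients `q + 1` and `p + q + 2` of `conditionalGap`.
  have hchoose : ((p + q + 1 : ℕ) : ℝ) * ((p + q).choose p : ℝ) =
      ((p + q + 1).choose p : ℝ) * (q + 1) := by
    have := Nat.choose_mul_succ_eq (p + q) p
    rw [show p + q + 1 - p = q + 1 by omega] at this
    rw [mul_comm]
    exact_mod_cast this
  have hpoint : ∀ a y : ℝ,
      ((p + q + 2 - 1 : ℕ) : ℝ) * (bernsteinPolynomial ℝ (p + q + 2 - 1 - 1)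
        (p + q + 2 - (q + 1) - 1)).eval (cdf ν y) * f y *
          cdf ν (((p + q + 2 : ℕ) : ℝ) * (a - y)) -
      ((p + q + 2 : ℕ) : ℝ) * (bernsteinPolynomial ℝ (p + q + 2 - 1)
        (p + q + 2 - (q + 1) - 1)).eval (cdf ν y) * f y * cdf ν (((q + 1 : ℕ) : ℝ) * (a - y)) =
      ((p + q + 1).choose p : ℝ) *
        (orderWeight p q (cdf ν) f y * conditionalGap p q (cdf ν) a y) := by
    intro a y
    rw [show p + q + 2 - 1 - 1 = p + q by omega, show p + q + 2 - 1 = p + q + 1 by omega,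
      show p + q + 2 - (q + 1) - 1 = p by omega]
    simp only [bernsteinPolynomial, Polynomial.eval_mul, Polynomial.eval_natCast,
      Polynomial.eval_pow, Polynomial.eval_X, Polynomial.eval_sub, Polynomial.eval_one]
    rw [show p + q - p = q by omega, show p + q + 1 - p = q + 1 by omega]
    simp only [← mul_assoc]
    rw [hchoose]
    simp only [orderWeight, conditionalGap]
    push_cast
    ring
  refine forall_congr' fun a => ?_
  refine Iff.trans ?_ (Eq.congr (hU a) (hV a)).symm
  rcases lt_or_ge a 0 with ha | ha
  -- For negative `a` both distribution functions vanish and the integral equation asks nothing.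
  · simp [max_eq_right ha.le, ha.not_ge]
  · have hi : ∀ (c : ℝ) (B : Polynomial ℝ) {s : ℝ}, 0 < s → IntervalIntegrable
        (fun y => c * B.eval (cdf ν y) * f y * cdf ν (s * (a - y))) volume 0 a := fun c B s hs =>
      ContinuousOn.intervalIntegrable (by
        rw [Set.uIcc_of_le ha]; exact continuousOn_eval_mul_mul_comp hcF hfc c B hs.le a)
    refine Iff.trans ?_ sub_eq_zero
    rw [max_eq_left ha, ← intervalIntegral.integral_sub (hi _ _ hn0) (hi _ _ hk0)]
    simp only [hpoint, intervalIntegral.integral_const_mul, mul_eq_zero, hκ.ne', false_or, ha,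
      true_implies]
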